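/- Let $\Omega_1,\Omega_2\subset\mathbb{R}^N$ be bounded open sets, let $p\in(2,\infty)$, and let $T$ be a map from $W^{1,p}(\Omega_1)$ to $W^{1,p}_{\mathrm{loc}}(\Omega_2)$ (real-valued functions). Here $W^{1,p}(\Omega)$ carries the norm $\|u\|_{W^{1,p}(\Omega)}^p=\int_\Omega|u|^p+\int_\Omega|\nabla u|^p$ with $|\cdot|$ the Euclidean norm, $W^{1,p}_0(\Omega)$ is the closure of $C_c^\infty(\Omega)$ in $W^{1,p}(\Omega)$, and $W^{1,p}_c(\Omega)$ is the set of functions in $W^{1,p}(\Omega)$ with compact support in $\Omega$. Put $$\mathfrak a_{p,\Omega}(u,v)=\int_\Omega|u|^{p-2}uv+\int_\Omega|\nabla u|^{p-2}\,\nabla u\cdot\nabla v .$$ Suppose that the following three conditions hold. (H1) There are $C^1$ functions $\xi\colon\Omega_2\to\mathbb{R}^N$ and $g\colon\Omega_2\to\mathbb{R}$ such that $\xi(y)\in\Omega_1$ for almost all $y\in\Omega_2$, the set $\{y\in\Omega_2: g(y)\ne0 \text{ and } \xi(y)\in S\}$ is a Lebesgue null set for every Lebesgue null set $S\subset\Omega_1$,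 and $Tu=g\cdot(u\circ\xi)$ almost everywhere on $\Omega_2$ for every $u\in W^{1,p}(\Omega_1)$. (H2) $\mathfrak a_{p,\Omega_2}(Tu,Tv)=\mathfrak a_{p,\Omega_1}(u,v)$ for all $u\in W^{1,p}(\Omega_1)$ and all $v\in W^{1,p}_0(\Omega_1)$ with $Tv\in W^{1,p}_c(\Omega_2)$. (H3) $W^{1,p}_0(\Omega_2)\subset T\,W^{1,p}_0(\Omega_1)$. Then $\nabla g=0$ everywhere on $\Omega_2$, for any $g$ as in (H1). -/

import Mathlib

open MeasureTheory
open scoped ContDiff RealInnerProductSpace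

noncomputable section

/-- `ℝᴺ` with its Euclidean norm. -/
abbrev Euc (N : ℕ) : Type := EuclideanSpace ℝ (Fin N)

/-- `φ` is a test function on `Ω`, i.e. `φ ∈ C_c^∞(Ω)`, extended by zero to `ℝᴺ`. -/
structure IsTestFun {N : ℕ} (Ω : Set (Euc N)) (φ : Euc N → ℝ) : Prop where
  smooth : ContDiff ℝ ∞ φ
  compact : HasCompactSupport φ
  support : tsupport φ ⊆ Ω

/-- `G` is the distributional gradient of `u` on the open set `Ω`:
`∫_Ω u ∇φ = - ∫_Ω φ G` for all test functions `φ` on `Ω`. -/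
structure HasWeakGradient {N : ℕ} (Ω : Set (Euc N)) (u : Euc N → ℝ) (G : Euc N → Euc N) :
    Prop where
  locInt : LocallyIntegrableOn u Ω
  locInt_grad : LocallyIntegrableOn G Ω
  integral_eq : ∀ φ : Euc N → ℝ, IsTestFun Ω φ →
    ∫ x in Ω, u x • gradient φ x = - ∫ x in Ω, φ x • G x

/-- Weak gradients are unique up to null sets. -/
theorem HasWeakGradient.ae_eq {N : ℕ} {Ω : Set (Euc N)} (hΩ : IsOpen Ω) {u : Euc N → ℝ}
    {G H : Euc N → Euc N} (hG : HasWeakGradient Ω u G) (hH : HasWeakGradient Ω u H) :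
    G =ᵐ[volume.restrict Ω] H := by
  have key : ∀ᵐ x, x ∈ Ω → (G - H) x = 0 := by
    refine hΩ.ae_eq_zero_of_integral_contDiff_smul_eq_zero
      (hG.locInt_grad.sub hH.locInt_grad) ?_
    intro φ h1 h2 h3
    have hint : ∀ K : Euc N → Euc N, LocallyIntegrableOn K Ω →
        Integrable (fun x => φ x • K x) := fun K hK => by
      have h4 : IntegrableOn (fun x => φ x • K x) (tsupport φ) :=
        (hK.integrableOn_compact_subset h3 h2).continuousOn_smul h1.continuous.continuousOn h2
      refine (integrableOn_iff_integrable_of_support_subset ?_).1 h4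
      intro x hx
      apply subset_tsupport
      intro h0
      apply hx
      simp [h0]
    have hset : ∀ K : Euc N → Euc N, ∫ x in Ω, φ x • K x = ∫ x, φ x • K x := fun K => by
      refine setIntegral_eq_integral_of_forall_compl_eq_zero fun x hx => ?_
      have : φ x = 0 := image_eq_zero_of_notMem_tsupport fun h => hx (h3 h)
      simp [this]
    have e1 := hG.integral_eq φ ⟨h1, h2, h3⟩
    have e2 := hH.integral_eq φ ⟨h1, h2, h3⟩
    rw [hset] at e1 e2
    have e3 := neg_injective (e1.symm.trans e2)
    simp only [Pi.sub_apply, smul_sub]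
    rw [integral_sub (hint _ hG.locInt_grad) (hint _ hH.locInt_grad), e3, sub_self]
  rw [Filter.EventuallyEq, ae_restrict_iff' hΩ.measurableSet]
  filter_upwards [key] with x hx hxΩ
  exact sub_eq_zero.1 (hx hxΩ)

open Classical in
/-- The weak gradient `∇u` of `u` on `Ω` (a representative of it; `0` if there is none). -/
def weakGrad {N : ℕ} (Ω : Set (Euc N)) (u : Euc N → ℝ) : Euc N → Euc N :=
  if h : ∃ G, HasWeakGradient Ω u G then h.choose else 0

/-- The Sobolev space `W^{1,p}(Ω)`: classes of a.e. equal functions on `Ω` that lie in `L^p(Ω)`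
and whose distributional gradient lies in `L^p(Ω)`. -/
def W1p {N : ℕ} (Ω : Set (Euc N)) (p : ℝ) : Set (Euc N →ₘ[volume.restrict Ω] ℝ) :=
  {u | MemLp u (ENNReal.ofReal p) (volume.restrict Ω) ∧
    ∃ G, HasWeakGradient Ω u G ∧ MemLp G (ENNReal.ofReal p) (volume.restrict Ω)}

/-- The local Sobolev space `W^{1,p}_loc(Ω)`. -/
def W1pLoc {N : ℕ} (Ω : Set (Euc N)) (p : ℝ) : Set (Euc N →ₘ[volume.restrict Ω] ℝ) :=
  {u | (∀ K ⊆ Ω, IsCompact K → MemLp u (ENNReal.ofReal p) (volume.restrict K)) ∧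
    ∃ G, HasWeakGradient Ω u G ∧
      ∀ K ⊆ Ω, IsCompact K → MemLp G (ENNReal.ofReal p) (volume.restrict K)}

/-- `W^{1,p}_c(Ω)`: the elements of `W^{1,p}(Ω)` that vanish a.e. outside a compact
subset of `Ω`. -/
def W1pc {N : ℕ} (Ω : Set (Euc N)) (p : ℝ) : Set (Euc N →ₘ[volume.restrict Ω] ℝ) :=
  {u | u ∈ W1p Ω p ∧ ∃ K ⊆ Ω, IsCompact K ∧ ∀ᵐ x ∂volume.restrict Ω, x ∉ K → u x = 0}

/-- The norm of `W^{1,p}(Ω)`. -/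
def W1pNorm {N : ℕ} (Ω : Set (Euc N)) (p : ℝ) (u : Euc N → ℝ) : ℝ :=
  ((∫ x in Ω, |u x| ^ p) + ∫ x in Ω, ‖weakGrad Ω u x‖ ^ p) ^ (1 / p)

/-- `W^{1,p}_0(Ω)`: the closure of the test functions in `W^{1,p}(Ω)`. -/
def W1p0 {N : ℕ} (Ω : Set (Euc N)) (p : ℝ) : Set (Euc N →ₘ[volume.restrict Ω] ℝ) :=
  {u | u ∈ W1p Ω p ∧
    ∀ ε > 0, ∃ φ : Euc N → ℝ, IsTestFun Ω φ ∧ W1pNorm Ω p (fun x => u x - φ x) < ε}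

/-- The form `𝔞_{p,Ω}(u,v) = ∫_Ω |u|^{p-2} u v + ∫_Ω |∇u|^{p-2} ∇u · ∇v`. -/
def aForm {N : ℕ} (Ω : Set (Euc N)) (p : ℝ) (u v : Euc N → ℝ) : ℝ :=
  (∫ x in Ω, |u x| ^ (p - 2) * u x * v x) +
    ∫ x in Ω, ‖weakGrad Ω u x‖ ^ (p - 2) * ⟪weakGrad Ω u x, weakGrad Ω v x⟫

/-- `T` is the weighted composition operator `u ↦ g · (u ∘ ξ)` with `C¹` functions
`ξ : Ω₂ → ℝᴺ` and `g : Ω₂ → ℝ` (only their values on `Ω₂` matter), where `ξ` maps almost all of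
`Ω₂` into `Ω₁` and pulls null sets back to null sets on `{g ≠ 0}`. -/
structure IsC1WeightedComposition {N : ℕ} {Ω₁ Ω₂ : Set (Euc N)} {p : ℝ} (T : W1p Ω₁ p → W1pLoc Ω₂ p)
    (ξ : Euc N → Euc N) (g : Euc N → ℝ) : Prop where
  contDiff_ξ : ContDiffOn ℝ 1 ξ Ω₂
  contDiff_g : ContDiffOn ℝ 1 g Ω₂
  mapsTo : ∀ᵐ y ∂volume.restrict Ω₂, ξ y ∈ Ω₁
  null : ∀ S ⊆ Ω₁, volume S = 0 → volume {y | y ∈ Ω₂ ∧ g y ≠ 0 ∧ ξ y ∈ S} = 0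
  eq : ∀ u : W1p Ω₁ p, ∀ᵐ y ∂volume.restrict Ω₂, (T u).1 y = g y * u.1 (ξ y)

/-- `T` intertwines the forms `𝔞_{p,Ω₁}` and `𝔞_{p,Ω₂}`. -/
def IntertwinesForms {N : ℕ} {Ω₁ Ω₂ : Set (Euc N)} {p : ℝ} (T : W1p Ω₁ p → W1pLoc Ω₂ p) : Prop :=
  ∀ u v : W1p Ω₁ p, v.1 ∈ W1p0 Ω₁ p → (T v).1 ∈ W1pc Ω₂ p →
    aForm Ω₂ p (T u).1 (T v).1 = aForm Ω₁ p u.1 v.1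

/-- `W^{1,p}_0(Ω₂) ⊆ T W^{1,p}_0(Ω₁)`. -/
def RangeContainsW1p0 {N : ℕ} {Ω₁ Ω₂ : Set (Euc N)} {p : ℝ} (T : W1p Ω₁ p → W1pLoc Ω₂ p) : Prop :=
  ∀ w ∈ W1p0 Ω₂ p, ∃ u : W1p Ω₁ p, u.1 ∈ W1p0 Ω₁ p ∧ (T u).1 = w

end

/-! Linearize the intertwining relation at the constant function 1. Since `T(1 + t f) = g + t g (f ∘
ξ)`, differentiating at `t = 0` against `v` with `Tv = φ` gives (`intertwining_first_variation`) an
identity between `(p - 1) ∫ f v` and a form with zeroth- and first-order parts in `g (f ∘ ξ)` and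
`φ`. No gradient term survives on `Ω₁`: the flux `|a|^(p-2) a` has zero derivative at `a = 0 = ∇1`,
because `p > 2`. On `Ω₂` the gradient term has coefficients given by the derivative of the flux at
`∇g`, which is positive definite where `∇g ≠ 0`.

This mismatch of order is detected by a double commutator. Near a point where `ξ` is a local
diffeomorphism and `g ≠ 0`, put `h = ⟪a, ·⟫` and insert `f ∘ ξ = h^j χ`, `φ = h^k χ` for `(j, k) =
(2, 0), (1, 1), (0, 2)` with weights `1, -2, 1`. All zeroth-order terms cancel; the gradient term
leaves only its principal symbol (`fluxDeriv_commutator`), so `∫ g χ² Q(a, a) = 0` with `Q` positive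
definite. If `∇g ≠ 0` at the point, this fails for `χ` supported where `g` has a sign and `∇g ≠ 0`.

Sard's lemma and the null-set condition provide such a point in every nonempty open set where `g ≠
0` (`IsC1WeightedComposition.exists_regular_point`). -/

/-! ### The p-Laplacian flux and its derivative -/

/-- The derivative of `a ↦ ‖a‖ ^ (p - 2) • a` in the direction `b`, paired with `c`. -/
noncomputable def fluxDeriv {E : Type*} [NormedAddCommGroup E] [InnerProductSpace ℝ E] (p : ℝ) (a b c : E) : ℝ :=
  ‖a‖ ^ (p - 2) * ⟪b, c⟫ + (p - 2) * ‖a‖ ^ (p - 4) * ⟪a, b⟫ * ⟪a, c⟫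

theorem norm_rpow_sub_four_mul_sq {E : Type*} [NormedAddCommGroup E] {p : ℝ} (a : E) (hp : 2 < p) :
    ‖a‖ ^ (p - 4) * ‖a‖ ^ 2 = ‖a‖ ^ (p - 2) := by
  rcases eq_or_ne a 0 with rfl | ha
  · rw [norm_zero, Real.zero_rpow (by linarith : p - 2 ≠ 0)]; simp
  · rw [← Real.rpow_natCast, ← Real.rpow_add (norm_pos_iff.2 ha)]
    congr 1; push_cast; ring

section Flux

variable {E : Type*} [NormedAddCommGroup E] [InnerProductSpace ℝ E] {p : ℝ}

theorem abs_fluxDeriv_le (hp : 2 < p) (a b c : E) :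
    |fluxDeriv p a b c| ≤ (p - 1) * ‖a‖ ^ (p - 2) * ‖b‖ * ‖c‖ := by
  have h0 : 0 ≤ ‖a‖ ^ (p - 2) := by positivity
  have h4 : 0 ≤ ‖a‖ ^ (p - 4) := by positivity
  have h1 : |‖a‖ ^ (p - 2) * ⟪b, c⟫| ≤ ‖a‖ ^ (p - 2) * (‖b‖ * ‖c‖) := by
    rw [abs_mul, abs_of_nonneg h0]
    exact mul_le_mul_of_nonneg_left (abs_real_inner_le_norm b c) h0
  have h2 : |(p - 2) * ‖a‖ ^ (p - 4) * ⟪a, b⟫ * ⟪a, c⟫|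
      ≤ (p - 2) * ‖a‖ ^ (p - 4) * (‖a‖ * ‖b‖) * (‖a‖ * ‖c‖) := by
    have h3 : 0 ≤ (p - 2) * ‖a‖ ^ (p - 4) := mul_nonneg (by linarith) h4
    rw [abs_mul, abs_mul, abs_of_nonneg h3]
    have := abs_real_inner_le_norm a b
    have := abs_real_inner_le_norm a c
    gcongr
  refine (abs_add_le _ _).trans ((add_le_add h1 h2).trans_eq ?_)
  rw [← norm_rpow_sub_four_mul_sq a hp]
  ring

/-- Where `a + t • b ≠ 0` this is the product rule. At a zero the difference quotient is `‖(s - t) •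
b‖ ^ (p - 2) * ⟪b, c⟫`, which tends to 0 because `p > 2`. -/
theorem hasDerivAt_flux (hp : 2 < p) (a b c : E) (t : ℝ) :
    HasDerivAt (fun s : ℝ => ‖a + s • b‖ ^ (p - 2) * ⟪a + s • b, c⟫)
      (fluxDeriv p (a + t • b) b c) t := by
  have hlin : HasDerivAt (fun s : ℝ => a + s • b) b t := by
    simpa using ((hasDerivAt_id t).smul_const b).const_add a
  by_cases h : a + t • b = 0
  · have ha : a = -(t • b) := eq_neg_of_add_eq_zero_left h
    have hk : ∀ s : ℝ, a + s • b = (s - t) • b := fun s => by rw [ha, sub_smul]; abel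
    have h0 : fluxDeriv p (a + t • b) b c = 0 := by
      rw [h, fluxDeriv, norm_zero, Real.zero_rpow (by linarith : p - 2 ≠ 0)]; simp
    rw [h0, hasDerivAt_iff_tendsto_slope]
    have hc : Continuous fun s : ℝ => ‖(s - t) • b‖ ^ (p - 2) * ⟪b, c⟫ := by
      refine Continuous.mul (Continuous.rpow_const (by fun_prop) fun _ => Or.inr (by linarith))
        continuous_const
    have hl : Filter.Tendsto (fun s : ℝ => ‖(s - t) • b‖ ^ (p - 2) * ⟪b, c⟫) (nhds t) (nhds 0) := by
      have := hc.tendsto t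
      rwa [sub_self, zero_smul, norm_zero, Real.zero_rpow (by linarith : p - 2 ≠ 0),
        zero_mul] at this
    refine (hl.mono_left nhdsWithin_le_nhds).congr' ?_
    filter_upwards [self_mem_nhdsWithin] with s hs
    have hs' : s - t ≠ 0 := sub_ne_zero.2 hs
    rw [slope_def_field, h, hk, real_inner_smul_left]
    simp only [inner_zero_left, mul_zero, sub_zero]
    field_simp
  · have hn : 0 < ‖a + t • b‖ := norm_pos_iff.2 h
    have hsq : HasDerivAt (fun s : ℝ => (‖a + s • b‖ ^ 2) ^ ((p - 2) / 2))
        ((p - 2) * ‖a + t • b‖ ^ (p - 4) * ⟪a + t • b, b⟫) t := by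
      have := hlin.norm_sq.rpow_const (p := (p - 2) / 2) (Or.inl (by positivity))
      convert this using 1
      rw [← Real.rpow_natCast, ← Real.rpow_mul hn.le]
      have : ((2 : ℕ) : ℝ) * ((p - 2) / 2 - 1) = p - 4 := by push_cast; ring
      rw [this]; ring
    have hpow : ∀ x : E, (‖x‖ ^ 2) ^ ((p - 2) / 2) = ‖x‖ ^ (p - 2) := fun x => by
      rw [← Real.rpow_natCast, ← Real.rpow_mul (norm_nonneg x)]
      congr 1; push_cast; ring
    simp only [hpow] at hsq
    have hin : HasDerivAt (fun s : ℝ => ⟪a + s • b, c⟫) ⟪b, c⟫ t := by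
      simpa using hlin.inner ℝ (hasDerivAt_const t c)
    refine (hsq.mul hin).congr_deriv ?_
    rw [fluxDeriv]
    ring

/-- Differentiation of `t ↦ ∫ ‖a + t b‖ ^ (p - 2) ⟪a + t b, c⟫` at `t = 0`. -/
theorem hasDerivAt_integral_flux {α : Type*} [MeasurableSpace α] {μ : Measure α} (hp : 2 < p)
    {a b c : α → E} (ha : AEStronglyMeasurable a μ) (hb : AEStronglyMeasurable b μ)
    (hc : Integrable c μ) {M : ℝ}
    (hM : ∀ᵐ x ∂μ, c x ≠ 0 → ‖a x‖ ≤ M ∧ ‖b x‖ ≤ M) :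
    Integrable (fun x => fluxDeriv p (a x) (b x) (c x)) μ ∧
      HasDerivAt (fun t : ℝ => ∫ x, ‖a x + t • b x‖ ^ (p - 2) * ⟪a x + t • b x, c x⟫ ∂μ)
        (∫ x, fluxDeriv p (a x) (b x) (c x) ∂μ) 0 := by
  have hmeas : ∀ t : ℝ, AEStronglyMeasurable
      (fun x => ‖a x + t • b x‖ ^ (p - 2) * ⟪a x + t • b x, c x⟫) μ := fun t => by
    have h1 : AEStronglyMeasurable (fun x => a x + t • b x) μ := ha.add (hb.const_smul t)
    exact (h1.norm.aemeasurable.pow_const _).aestronglyMeasurable.mul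
      (h1.inner hc.aestronglyMeasurable)
  have key := hasDerivAt_integral_of_dominated_loc_of_deriv_le (μ := μ) (𝕜 := ℝ)
    (F := fun t x => ‖a x + t • b x‖ ^ (p - 2) * ⟪a x + t • b x, c x⟫)
    (F' := fun t x => fluxDeriv p (a x + t • b x) (b x) (c x)) (x₀ := 0)
    -- For `|t| < 1`, `‖a + t • b‖ ≤ 2 * M` wherever `c ≠ 0`. Elsewhere the integrand vanishes, so
    -- `a` and `b` may be unbounded there, as `g` and `∇g` may be near the boundary of `Ω₂`.
    (bound := fun x => (p - 1) * (2 * M) ^ (p - 2) * M * ‖c x‖) (s := Metric.ball 0 1)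
    (Metric.ball_mem_nhds _ one_pos) (Filter.Eventually.of_forall hmeas) ?_ ?_ ?_
    (hc.norm.const_mul _) ?_
  · simpa using key
  · refine (hc.norm.const_mul (M ^ (p - 2) * M)).mono' (hmeas 0) ?_
    filter_upwards [hM] with x hx
    by_cases hcx : c x = 0
    · simp [hcx]
    · have := (hx hcx).1
      have hM0 : 0 ≤ M := (norm_nonneg _).trans this
      have hp2 : 0 ≤ p - 2 := by linarith
      simp only [zero_smul, add_zero, Real.norm_eq_abs, abs_mul]
      rw [abs_of_nonneg (by positivity : 0 ≤ ‖a x‖ ^ (p - 2)), mul_assoc]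
      have h2 := abs_real_inner_le_norm (a x) (c x)
      have h3 : ‖a x‖ * ‖c x‖ ≤ M * ‖c x‖ := by gcongr
      exact mul_le_mul (Real.rpow_le_rpow (norm_nonneg _) this hp2) (h2.trans h3) (abs_nonneg _)
        (by positivity)
  · simp only [zero_smul, add_zero, fluxDeriv]
    have h1 := fun q : ℝ => (ha.norm.aemeasurable.pow_const q).aestronglyMeasurable
    exact ((h1 _).mul (hb.inner hc.aestronglyMeasurable)).add
      ((((h1 _).const_mul _).mul (ha.inner hb)).mul (ha.inner hc.aestronglyMeasurable))
  · filter_upwards [hM] with x hx t ht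
    by_cases hcx : c x = 0
    · simp [hcx, fluxDeriv]
    · obtain ⟨h1, h2⟩ := hx hcx
      have hM0 : 0 ≤ M := (norm_nonneg _).trans h1
      have hp2 : 0 ≤ p - 2 := by linarith
      have ht' : |t| ≤ 1 := by
        have := (mem_ball_zero_iff.1 ht).le
        simpa using this
      have h3 : ‖a x + t • b x‖ ≤ 2 * M := by
        refine (norm_add_le _ _).trans ?_
        rw [norm_smul, Real.norm_eq_abs]
        nlinarith [norm_nonneg (b x), abs_nonneg t]
      refine (abs_fluxDeriv_le hp _ _ _).trans ?_
      have h4 := Real.rpow_le_rpow (norm_nonneg _) h3 hp2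
      have : 0 ≤ p - 1 := by linarith
      gcongr
  · exact Filter.Eventually.of_forall fun x t _ => hasDerivAt_flux hp _ _ _ t

end Flux

/-! ### Weak gradients of C¹ functions -/

section WeakGradient

variable {N : ℕ} {Ω : Set (Euc N)}

theorem LocallyIntegrableOn.congr_ae_restrict {F : Type*} [NormedAddCommGroup F]
    {u v : Euc N → F} (hu : LocallyIntegrableOn u Ω)
    (huv : u =ᵐ[volume.restrict Ω] v) : LocallyIntegrableOn v Ω := by
  intro x hx
  obtain ⟨s, hs, hus⟩ := hu x hx
  refine ⟨s ∩ Ω, Filter.inter_mem hs self_mem_nhdsWithin, ?_⟩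
  have h1 : IntegrableOn u (s ∩ Ω) := hus.mono_set Set.inter_subset_left
  exact Integrable.congr h1 (ae_restrict_of_ae_restrict_of_subset Set.inter_subset_right huv)

theorem HasWeakGradient.congr {u v : Euc N → ℝ} {G : Euc N → Euc N} 
    (hu : HasWeakGradient Ω u G) (huv : u =ᵐ[volume.restrict Ω] v) : HasWeakGradient Ω v G where
  locInt := LocallyIntegrableOn.congr_ae_restrict hu.locInt huv
  locInt_grad := hu.locInt_grad
  integral_eq φ hφ := by
    rw [← hu.integral_eq φ hφ]
    refine integral_congr_ae ?_
    filter_upwards [huv] with x hx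
    rw [hx]

theorem weakGrad_ae_eq (hΩ : IsOpen Ω) {u : Euc N → ℝ} {G : Euc N → Euc N}
    (hu : HasWeakGradient Ω u G) : weakGrad Ω u =ᵐ[volume.restrict Ω] G := by
  have h : ∃ G, HasWeakGradient Ω u G := ⟨G, hu⟩
  rw [weakGrad, dif_pos h]
  exact h.choose_spec.ae_eq hΩ hu

theorem ContDiffOn.continuousOn_gradient {u : Euc N → ℝ} (hΩ : IsOpen Ω)
    (hu : ContDiffOn ℝ 1 u Ω) : ContinuousOn (gradient u) Ω :=
  (InnerProductSpace.toDual ℝ (Euc N)).symm.continuous.comp_continuousOn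
    (hu.continuousOn_fderiv_of_isOpen hΩ le_rfl)

theorem ContDiff.continuous_gradient {u : Euc N → ℝ} (hu : ContDiff ℝ 1 u) :
    Continuous (gradient u) :=
  (InnerProductSpace.toDual ℝ (Euc N)).symm.continuous.comp (hu.continuous_fderiv one_ne_zero)

theorem hasCompactSupport_gradient {u : Euc N → ℝ} (hu : HasCompactSupport u) :
    HasCompactSupport (gradient u) :=
  (hu.fderiv ℝ).comp_left (map_zero (InnerProductSpace.toDual ℝ (Euc N)).symm)

theorem gradient_eq_zero_of_notMem_tsupport {u : Euc N → ℝ} {x : Euc N} (hx : x ∉ tsupport u) :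
    gradient u x = 0 := by
  rw [gradient, fderiv_of_notMem_tsupport ℝ hx, map_zero]

theorem gradient_mul_apply {u v : Euc N → ℝ} {x : Euc N} (hu : DifferentiableAt ℝ u x)
    (hv : DifferentiableAt ℝ v x) :
    gradient (fun y => u y * v y) x = u x • gradient v x + v x • gradient u x := by
  simp only [gradient, fderiv_fun_mul hu hv, map_add, map_smulₛₗ, conj_trivial]

theorem gradient_add_const_mul {u v : Euc N → ℝ} {x : Euc N} (t : ℝ)
    (hu : DifferentiableAt ℝ u x) (hv : DifferentiableAt ℝ v x) :
    gradient (fun y => u y + t * v y) x = gradient u x + t • gradient v x := by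
  simp only [gradient, fderiv_fun_add hu (hv.const_mul t), fderiv_const_mul hv, map_add,
    map_smulₛₗ, conj_trivial]

/-- A product with a function of compact support is as smooth as on a neighbourhood of that
support. -/
theorem ContDiffOn.contDiff_mul_of_tsupport_subset {n : WithTop ℕ∞} {u φ : Euc N → ℝ}
    (hΩ : IsOpen Ω) (hu : ContDiffOn ℝ n u Ω) (hφ : ContDiff ℝ n φ) (hs : tsupport φ ⊆ Ω) :
    ContDiff ℝ n fun x => u x * φ x := by
  rw [contDiff_iff_contDiffAt]
  intro x
  by_cases hx : x ∈ tsupport φ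
  · exact (hu.contDiffAt (hΩ.mem_nhds (hs hx))).mul hφ.contDiffAt
  · refine (contDiffAt_const (c := (0 : ℝ))).congr_of_eventuallyEq ?_
    filter_upwards [(isClosed_tsupport φ).isOpen_compl.mem_nhds hx] with y hy
    simp [image_eq_zero_of_notMem_tsupport hy]

theorem integral_fderiv_apply_eq_zero {u : Euc N → ℝ} (hu : ContDiff ℝ 1 u)
    (hc : HasCompactSupport u) (v : Euc N) : ∫ x, fderiv ℝ u x v = 0 := by
  have hd : Continuous fun x => fderiv ℝ u x v :=
    (hu.continuous_fderiv one_ne_zero).clm_apply continuous_const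
  have hdc : HasCompactSupport fun x => fderiv ℝ u x v :=
    (hc.fderiv ℝ).comp_left (g := fun L : Euc N →L[ℝ] ℝ => L v) rfl
  have i1 : Integrable fun x => (1 : ℝ) * fderiv ℝ u x v := by
    simpa only [one_mul] using hd.integrable_of_hasCompactSupport hdc
  have i2 : Integrable fun x => (1 : ℝ) * u x := by
    simpa only [one_mul] using hu.continuous.integrable_of_hasCompactSupport hc
  have i3 : Integrable fun x : Euc N => fderiv ℝ (fun _ : Euc N => (1 : ℝ)) x v * u x := by
    simp only [fderiv_fun_const, Pi.zero_apply, zero_apply, zero_mul]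
    exact integrable_zero _ _ _
  -- Integration by parts against the constant 1.
  have h := integral_mul_fderiv_eq_neg_fderiv_mul_of_integrable i3 i1 i2
    (fun x _ => differentiableAt_const _) (fun x _ => hu.differentiable one_ne_zero x)
  simpa only [one_mul, fderiv_fun_const, Pi.zero_apply, zero_apply, zero_mul,
    integral_zero, neg_zero] using h

theorem integral_gradient_eq_zero {u : Euc N → ℝ} (hu : ContDiff ℝ 1 u)
    (hc : HasCompactSupport u) : ∫ x, gradient u x = 0 := by
  have hint : Integrable (gradient u) :=
    hu.continuous_gradient.integrable_of_hasCompactSupport (hasCompactSupport_gradient hc)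
  refine ext_inner_left ℝ fun v => ?_
  rw [← integral_inner hint, inner_zero_right, ← integral_fderiv_apply_eq_zero hu hc v]
  refine integral_congr_ae (Filter.Eventually.of_forall fun x => ?_)
  simp only [inner_gradient_right, conj_trivial]

/-- The product `u φ` is C¹ with compact support on the whole space, so its gradient integrates to
zero; the product rule does the rest. -/
theorem HasWeakGradient.of_contDiffOn {u : Euc N → ℝ} (hΩ : IsOpen Ω) (hu : ContDiffOn ℝ 1 u Ω) :
    HasWeakGradient Ω u (gradient u) where
  locInt := hu.continuousOn.locallyIntegrableOn hΩ.measurableSet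
  locInt_grad := (hu.continuousOn_gradient hΩ).locallyIntegrableOn hΩ.measurableSet
  integral_eq φ hφ := by
    have hφ1 : ContDiff ℝ 1 φ := hφ.smooth.of_le (by norm_cast)
    have hint : ∀ k : Euc N → Euc N, ContinuousOn k Ω → (∀ x ∉ tsupport φ, k x = 0) →
        IntegrableOn k Ω := fun k hk h0 =>
      ((hk.mono hφ.support).integrableOn_compact hφ.compact).of_forall_sdiff_eq_zero
        hΩ.measurableSet fun x hx => h0 x hx.2
    have i1 : IntegrableOn (fun x => u x • gradient φ x) Ω :=
      hint _ (hu.continuousOn.smul hφ1.continuous_gradient.continuousOn) fun x hx => by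
        rw [gradient_eq_zero_of_notMem_tsupport hx, smul_zero]
    have i2 : IntegrableOn (fun x => φ x • gradient u x) Ω :=
      hint _ (hφ1.continuous.continuousOn.smul (hu.continuousOn_gradient hΩ)) fun x hx => by
        rw [image_eq_zero_of_notMem_tsupport hx, zero_smul]
    have hψ := hu.contDiff_mul_of_tsupport_subset hΩ hφ1 hφ.support
    have hψc : HasCompactSupport fun x => u x * φ x := hφ.compact.mul_left
    have h0 := integral_gradient_eq_zero hψ hψc
    rw [← setIntegral_eq_integral_of_forall_compl_eq_zero (s := Ω)] at h0
    · rw [eq_neg_iff_add_eq_zero, ← integral_add i1 i2, ← h0]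
      refine setIntegral_congr_fun hΩ.measurableSet fun x hx => ?_
      exact (gradient_mul_apply
        ((hu.contDiffAt (hΩ.mem_nhds hx)).differentiableAt one_ne_zero)
        (hφ1.differentiable one_ne_zero x)).symm
    · intro x hx
      refine gradient_eq_zero_of_notMem_tsupport fun h => hx (hφ.support ?_)
      exact tsupport_mul_subset_right h

theorem weakGrad_ae_eq_gradient {u v : Euc N → ℝ} (hΩ : IsOpen Ω) (hv : ContDiffOn ℝ 1 v Ω)
    (huv : u =ᵐ[volume.restrict Ω] v) : weakGrad Ω u =ᵐ[volume.restrict Ω] gradient v :=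
  weakGrad_ae_eq hΩ ((HasWeakGradient.of_contDiffOn hΩ hv).congr huv.symm)

variable {p : ℝ}

theorem exists_mem_W1p_ae_eq (hΩ : IsOpen Ω) (hb : Bornology.IsBounded Ω) {u : Euc N → ℝ}
    (hu : ContDiff ℝ 1 u) {C : ℝ} (hC : ∀ x, ‖u x‖ ≤ C) (hC' : ∀ x, ‖gradient u x‖ ≤ C) :
    ∃ U ∈ W1p Ω p, U =ᵐ[volume.restrict Ω] u := by
  have : IsFiniteMeasure (volume.restrict Ω) := ⟨by simpa using hb.measure_lt_top⟩
  have hm : AEStronglyMeasurable u (volume.restrict Ω) := hu.continuous.aestronglyMeasurable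
  have hU := AEEqFun.coeFn_mk u hm
  refine ⟨AEEqFun.mk u hm, ⟨?_, gradient u, ?_, ?_⟩, hU⟩
  · exact (memLp_congr_ae hU).2 (MemLp.of_bound hm C (Filter.Eventually.of_forall hC))
  · exact (HasWeakGradient.of_contDiffOn hΩ hu.contDiffOn).congr hU.symm
  · exact MemLp.of_bound hu.continuous_gradient.aestronglyMeasurable C
      (Filter.Eventually.of_forall hC')

theorem exists_bound_gradient_of_hasCompactSupport {u : Euc N → ℝ} (hu : ContDiff ℝ 1 u)
    (hc : HasCompactSupport u) : ∃ C, ∀ x, ‖u x‖ ≤ C ∧ ‖gradient u x‖ ≤ C := by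
  obtain ⟨A, hA⟩ := hc.exists_bound_of_continuous hu.continuous
  obtain ⟨B, hB⟩ := (hasCompactSupport_gradient hc).exists_bound_of_continuous hu.continuous_gradient
  exact ⟨max A B, fun x => ⟨(hA x).trans (le_max_left _ _), (hB x).trans (le_max_right _ _)⟩⟩

theorem IsTestFun.contDiff_one {φ : Euc N → ℝ} (hφ : IsTestFun Ω φ) : ContDiff ℝ 1 φ :=
  hφ.smooth.of_le (by norm_cast)

theorem IsTestFun.exists_mem_W1p0 (hΩ : IsOpen Ω) (hb : Bornology.IsBounded Ω) (hp : 2 < p)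
    {φ : Euc N → ℝ} (hφ : IsTestFun Ω φ) :
    ∃ w ∈ W1p0 Ω p, w ∈ W1pc Ω p ∧ w =ᵐ[volume.restrict Ω] φ := by
  obtain ⟨C, hC⟩ := exists_bound_gradient_of_hasCompactSupport hφ.contDiff_one hφ.compact
  obtain ⟨w, hw, hwφ⟩ := exists_mem_W1p_ae_eq (p := p) hΩ hb hφ.contDiff_one
    (fun x => (hC x).1) (fun x => (hC x).2)
  refine ⟨w, ⟨hw, fun ε hε => ⟨φ, hφ, ?_⟩⟩, ⟨hw, tsupport φ, hφ.support, hφ.compact, ?_⟩, hwφ⟩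
  · have h0 : (fun x => w x - φ x) =ᵐ[volume.restrict Ω] fun _ => (0 : ℝ) := by
      filter_upwards [hwφ] with x hx
      rw [hx, sub_self]
    have h1 := weakGrad_ae_eq_gradient hΩ contDiffOn_const h0
    have e1 : ∫ x in Ω, |w x - φ x| ^ p = 0 := by
      refine (integral_congr_ae (g := fun _ => (0 : ℝ)) ?_).trans (by simp)
      filter_upwards [h0] with x hx
      rw [hx, abs_zero, Real.zero_rpow (by linarith)]
    have e2 : ∫ x in Ω, ‖weakGrad Ω (fun x => w x - φ x) x‖ ^ p = 0 := by
      refine (integral_congr_ae (g := fun _ => (0 : ℝ)) ?_).trans (by simp)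
      filter_upwards [h1] with x hx
      rw [hx, gradient_fun_const, norm_zero, Real.zero_rpow (by linarith)]
    rw [W1pNorm, e1, e2, add_zero, Real.zero_rpow (by rw [one_div]; exact inv_ne_zero (by linarith))]
    exact hε
  · filter_upwards [hwφ] with x hx hxs
    rw [hx, image_eq_zero_of_notMem_tsupport hxs]

end WeakGradient

/-! ### First variation of the intertwining relation -/

section Linearization

variable {N : ℕ} {Ω Ω₁ Ω₂ : Set (Euc N)} {p : ℝ}

/-- The null-set condition makes the formula for `T` independent of the representative: where `g =
0` both sides vanish, and elsewhere `ξ` pulls the exceptional set back to a null set. -/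
theorem IsC1WeightedComposition.ae_eq_of_ae_eq {T : W1p Ω₁ p → W1pLoc Ω₂ p} {ξ : Euc N → Euc N}
    {g : Euc N → ℝ} (h : IsC1WeightedComposition T ξ g) (hΩ₁ : IsOpen Ω₁)
    (hΩ₂ : IsOpen Ω₂) {u : W1p Ω₁ p}
    {f : Euc N → ℝ} (hu : u.1 =ᵐ[volume.restrict Ω₁] f) :
    (T u).1 =ᵐ[volume.restrict Ω₂] fun y => g y * f (ξ y) := by
  rw [Filter.EventuallyEq, ae_restrict_iff' hΩ₁.measurableSet] at hu
  have hS : volume {x | x ∈ Ω₁ ∧ u.1 x ≠ f x} = 0 := by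
    refine measure_mono_null (fun x hx => ?_) (ae_iff.1 hu)
    exact fun h => hx.2 (h hx.1)
  have hn : ∀ᵐ y ∂volume.restrict Ω₂,
      ¬ (y ∈ Ω₂ ∧ g y ≠ 0 ∧ ξ y ∈ {x | x ∈ Ω₁ ∧ u.1 x ≠ f x}) := by
    refine ae_restrict_of_ae (ae_iff.2 ?_)
    simpa only [not_not] using h.null _ (fun x hx => hx.1) hS
  filter_upwards [h.mapsTo, h.eq u, hn, ae_restrict_mem hΩ₂.measurableSet] with y h1 h2 h3 h4
  rw [h2]
  by_cases hg : g y = 0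
  · rw [hg, zero_mul, zero_mul]
  · congr 1
    by_contra hne
    exact h3 ⟨h4, hg, h1, hne⟩

theorem integrable_of_memLp_ofReal (hb : Bornology.IsBounded Ω) (hp : 2 < p) {F : Type*}
    [NormedAddCommGroup F] {u : Euc N → F}
    (hu : MemLp u (ENNReal.ofReal p) (volume.restrict Ω)) : IntegrableOn u Ω := by
  have : IsFiniteMeasure (volume.restrict Ω) := ⟨by simpa using hb.measure_lt_top⟩
  exact hu.integrable (by rw [ENNReal.one_le_ofReal]; linarith)

theorem integrableOn_weakGrad_of_mem_W1p (hΩ : IsOpen Ω) (hb : Bornology.IsBounded Ω) (hp : 2 < p)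
    {u : Euc N →ₘ[volume.restrict Ω] ℝ} (hu : u ∈ W1p Ω p) : IntegrableOn (weakGrad Ω u) Ω := by
  obtain ⟨-, G, hG, hGp⟩ := hu
  exact (integrable_of_memLp_ofReal hb hp hGp).congr (weakGrad_ae_eq hΩ hG).symm

/-- Puts the scalar term into flux form with `E = ℝ`, so that one differentiation lemma serves both
terms of the form. -/
theorem aForm_congr {u v a b : Euc N → ℝ} {G H : Euc N → Euc N}
    (hu : u =ᵐ[volume.restrict Ω] a) (hv : v =ᵐ[volume.restrict Ω] b)
    (hG : weakGrad Ω u =ᵐ[volume.restrict Ω] G) (hH : weakGrad Ω v =ᵐ[volume.restrict Ω] H) :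
    aForm Ω p u v = (∫ x in Ω, ‖a x‖ ^ (p - 2) * ⟪a x, b x⟫) +
      ∫ x in Ω, ‖G x‖ ^ (p - 2) * ⟪G x, H x⟫ := by
  rw [aForm]
  congr 1
  · refine integral_congr_ae ?_
    filter_upwards [hu, hv] with x h1 h2
    rw [h1, h2, Real.norm_eq_abs, real_inner_comm, RCLike.inner_apply, conj_trivial, mul_assoc]
  · refine integral_congr_ae ?_
    filter_upwards [hG, hH] with x h1 h2
    rw [h1, h2]

/-- The first variation of the intertwining relation at the constant function `1`, in the
direction of a compactly supported `C¹` function `f`. -/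
theorem intertwining_first_variation
    (hΩ₁ : IsOpen Ω₁) (hΩ₁b : Bornology.IsBounded Ω₁) (hΩ₂ : IsOpen Ω₂)
    (hp : 2 < p) {T : W1p Ω₁ p → W1pLoc Ω₂ p} {ξ : Euc N → Euc N} {g : Euc N → ℝ}
    (h1 : IsC1WeightedComposition T ξ g) (h2 : IntertwinesForms T)
    {f φ : Euc N → ℝ} (hf : ContDiff ℝ 1 f) (hfc : HasCompactSupport f) (hφ : IsTestFun Ω₂ φ)
    (v : W1p Ω₁ p) (hv : v.1 ∈ W1p0 Ω₁ p) (hTv : (T v).1 ∈ W1pc Ω₂ p)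
    (hvφ : (T v).1 =ᵐ[volume.restrict Ω₂] φ) :
    IntegrableOn (fun x => f x * v.1 x) Ω₁ ∧
    IntegrableOn (fun y => fluxDeriv p (g y) (g y * f (ξ y)) (φ y)) Ω₂ ∧
    IntegrableOn
      (fun y => fluxDeriv p (gradient g y) (gradient (fun z => g z * f (ξ z)) y) (gradient φ y))
      Ω₂ ∧
    (p - 1) * ∫ x in Ω₁, f x * v.1 x =
      (∫ y in Ω₂, fluxDeriv p (g y) (g y * f (ξ y)) (φ y)) +
      ∫ y in Ω₂,
        fluxDeriv p (gradient g y) (gradient (fun z => g z * f (ξ z)) y) (gradient φ y) := by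
  obtain ⟨C, hC⟩ := exists_bound_gradient_of_hasCompactSupport hf hfc
  have hgf : ContDiffOn ℝ 1 (fun y => g y * f (ξ y)) Ω₂ :=
    h1.contDiff_g.mul (hf.comp_contDiffOn h1.contDiff_ξ)
  have hφ1 := hφ.contDiff_one
  have hvi : IntegrableOn v.1 Ω₁ := integrable_of_memLp_ofReal hΩ₁b hp v.2.1
  have hvg := integrableOn_weakGrad_of_mem_W1p hΩ₁ hΩ₁b hp v.2
  have hbound : ∀ {F : Type} [NormedAddCommGroup F] (a b : Euc N → F), ContinuousOn a Ω₂ →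
      ContinuousOn b Ω₂ → ∃ M, ∀ y ∈ tsupport φ, ‖a y‖ ≤ M ∧ ‖b y‖ ≤ M := fun a b ha hb => by
    obtain ⟨A, hA⟩ := hφ.compact.exists_bound_of_continuousOn (ha.mono hφ.support)
    obtain ⟨B, hB⟩ := hφ.compact.exists_bound_of_continuousOn (hb.mono hφ.support)
    exact ⟨max A B, fun y hy => ⟨(hA y hy).trans (le_max_left _ _),
      (hB y hy).trans (le_max_right _ _)⟩⟩
  have d1 := hasDerivAt_integral_flux (μ := volume.restrict Ω₁) hp (a := fun _ => (1 : ℝ)) (b := f)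
    (c := v.1) aestronglyMeasurable_const hf.continuous.aestronglyMeasurable hvi (M := max 1 C)
    (Filter.Eventually.of_forall fun x _ => ⟨by simp, (hC x).1.trans (le_max_right _ _)⟩)
  have d2 := hasDerivAt_integral_flux (μ := volume.restrict Ω₁) hp (a := fun _ => (0 : Euc N))
    (b := gradient f) (c := weakGrad Ω₁ v.1) aestronglyMeasurable_const
    hf.continuous_gradient.aestronglyMeasurable hvg (M := C)
    (Filter.Eventually.of_forall fun x _ =>
      ⟨by simpa using (norm_nonneg _).trans (hC x).1, (hC x).2⟩)
  obtain ⟨M, hM⟩ := hbound g (fun y => g y * f (ξ y)) h1.contDiff_g.continuousOn hgf.continuousOn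
  have d3 := hasDerivAt_integral_flux (μ := volume.restrict Ω₂) hp (a := g)
    (b := fun y => g y * f (ξ y)) (c := φ)
    (h1.contDiff_g.continuousOn.aestronglyMeasurable hΩ₂.measurableSet)
    (hgf.continuousOn.aestronglyMeasurable hΩ₂.measurableSet)
    (hφ1.continuous.integrable_of_hasCompactSupport hφ.compact).integrableOn (M := M)
    (Filter.Eventually.of_forall fun y hy => hM y (subset_tsupport _ hy))
  obtain ⟨M', hM'⟩ := hbound (gradient g) (gradient fun y => g y * f (ξ y))
    (h1.contDiff_g.continuousOn_gradient hΩ₂) (hgf.continuousOn_gradient hΩ₂)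
  have d4 := hasDerivAt_integral_flux (μ := volume.restrict Ω₂) hp (a := gradient g)
    (b := gradient fun y => g y * f (ξ y)) (c := gradient φ)
    ((h1.contDiff_g.continuousOn_gradient hΩ₂).aestronglyMeasurable hΩ₂.measurableSet)
    ((hgf.continuousOn_gradient hΩ₂).aestronglyMeasurable hΩ₂.measurableSet)
    (hφ1.continuous_gradient.integrable_of_hasCompactSupport
      (hasCompactSupport_gradient hφ.compact)).integrableOn (M := M')
    (Filter.Eventually.of_forall fun y hy => hM' y (by
      by_contra h
      exact hy (gradient_eq_zero_of_notMem_tsupport h)))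
  have e1 : ∀ x, fluxDeriv p (1 : ℝ) (f x) (v.1 x) = (p - 1) * (f x * v.1 x) := fun x => by
    simp only [fluxDeriv, norm_one, Real.one_rpow, RCLike.inner_apply, conj_trivial]
    ring
  -- The gradient term on `Ω₁` drops out because `∇1 = 0` and `p > 2`.
  have e2 : ∀ b c : Euc N, fluxDeriv p 0 b c = 0 := fun b c => by
    rw [fluxDeriv, norm_zero, Real.zero_rpow (by linarith)]
    simp
  simp only [e1, e2, integral_zero] at d1 d2
  -- The intertwining relation for `1 + t f`, which lies in the Sobolev space because `Ω₁` is
  -- bounded.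
  have heq : ∀ t : ℝ,
      (∫ x in Ω₁, ‖(1 : ℝ) + t • f x‖ ^ (p - 2) * ⟪(1 : ℝ) + t • f x, v.1 x⟫) +
        (∫ x in Ω₁, ‖(0 : Euc N) + t • gradient f x‖ ^ (p - 2) *
          ⟪(0 : Euc N) + t • gradient f x, weakGrad Ω₁ v.1 x⟫) =
      (∫ y in Ω₂, ‖g y + t • (g y * f (ξ y))‖ ^ (p - 2) *
        ⟪g y + t • (g y * f (ξ y)), φ y⟫) +
        ∫ y in Ω₂, ‖gradient g y + t • gradient (fun z => g z * f (ξ z)) y‖ ^ (p - 2) *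
          ⟪gradient g y + t • gradient (fun z => g z * f (ξ z)) y, gradient φ y⟫ := by
    intro t
    have hut : ContDiff ℝ 1 fun x => 1 + t * f x := contDiff_const.add (contDiff_const.mul hf)
    have hgrad : ∀ x, gradient (fun x => 1 + t * f x) x = 0 + t • gradient f x := fun x => by
      rw [gradient_add_const_mul t (differentiableAt_const _) (hf.differentiable one_ne_zero x),
        gradient_fun_const]
    have hC0 : 0 ≤ C := (norm_nonneg _).trans (hC 0).1
    obtain ⟨U, hU, hUu⟩ := exists_mem_W1p_ae_eq (p := p) hΩ₁ hΩ₁b hut (C := 1 + |t| * C)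
      (fun x => by
        refine (norm_add_le _ _).trans ?_
        rw [norm_one, norm_mul, Real.norm_eq_abs t]
        have := (hC x).1
        gcongr)
      (fun x => by
        rw [hgrad, zero_add, norm_smul, Real.norm_eq_abs]
        have := mul_le_mul_of_nonneg_left (hC x).2 (abs_nonneg t)
        linarith)
    have hTU := h1.ae_eq_of_ae_eq hΩ₁ hΩ₂ (u := ⟨U, hU⟩) hUu
    have hTU' : (T ⟨U, hU⟩).1 =ᵐ[volume.restrict Ω₂] fun y => g y + t * (g y * f (ξ y)) := by
      filter_upwards [hTU] with y hy
      rw [hy]; ring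
    have hw : weakGrad Ω₂ (T ⟨U, hU⟩).1 =ᵐ[volume.restrict Ω₂]
        fun y => gradient g y + t • gradient (fun z => g z * f (ξ z)) y := by
      refine (weakGrad_ae_eq_gradient hΩ₂ (h1.contDiff_g.add (contDiffOn_const.mul hgf)) hTU').trans
        ?_
      filter_upwards [ae_restrict_mem hΩ₂.measurableSet] with y hy
      exact gradient_add_const_mul t
        ((h1.contDiff_g.contDiffAt (hΩ₂.mem_nhds hy)).differentiableAt one_ne_zero)
        ((hgf.contDiffAt (hΩ₂.mem_nhds hy)).differentiableAt one_ne_zero)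
    have hw1 : weakGrad Ω₁ U =ᵐ[volume.restrict Ω₁] fun x => 0 + t • gradient f x := by
      refine (weakGrad_ae_eq_gradient hΩ₁ hut.contDiffOn hUu).trans ?_
      exact Filter.Eventually.of_forall hgrad
    have key := h2 ⟨U, hU⟩ v hv hTv
    rw [aForm_congr hTU' hvφ hw (weakGrad_ae_eq_gradient hΩ₂ hφ1.contDiffOn hvφ),
      aForm_congr hUu (Filter.EventuallyEq.refl _ _) hw1 (Filter.EventuallyEq.refl _ _)] at key
    exact key.symm
  have hD := d1.2.add d2.2
  have hD' := d3.2.add d4.2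
  refine ⟨?_, d3.1, d4.1, ?_⟩
  · have := d1.1.const_mul (p - 1)⁻¹
    rw [IntegrableOn]
    simpa only [inv_mul_cancel_left₀ (by linarith : p - 1 ≠ 0)] using this
  · rw [integral_const_mul, add_zero] at hD
    exact hD.unique (hD'.congr_of_eventuallyEq (Filter.Eventually.of_forall heq))

end Linearization

/-! ### Regular points and local inversion of ξ -/

section LocalInverse

variable {N : ℕ} {Ω Ω₁ Ω₂ : Set (Euc N)} {p : ℝ}

/-- By Sard's lemma, a weighted composition operator has regular points in every nonempty open
set on which the weight does not vanish. -/
theorem IsC1WeightedComposition.exists_regular_point {T : W1p Ω₁ p → W1pLoc Ω₂ p}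
    {ξ : Euc N → Euc N} {g : Euc N → ℝ} (h : IsC1WeightedComposition T ξ g) (hΩ₂ : IsOpen Ω₂)
    {U : Set (Euc N)} (hU : IsOpen U) (hUΩ : U ⊆ Ω₂) (hne : U.Nonempty)
    (hg : ∀ y ∈ U, g y ≠ 0) : ∃ y ∈ U, ξ y ∈ Ω₁ ∧ (fderiv ℝ ξ y).det ≠ 0 := by
  by_contra! hcon
  -- If every such point were critical, this image would be null by Sard; its preimage in `U`, which
  -- is almost all of `U`, would then be null too.
  have hS : volume (ξ '' {y | y ∈ U ∧ ξ y ∈ Ω₁}) = 0 :=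
    addHaar_image_eq_zero_of_det_fderivWithin_eq_zero volume (f' := fderiv ℝ ξ)
      (fun y hy => ((h.contDiff_ξ.contDiffAt (hΩ₂.mem_nhds (hUΩ hy.1))).differentiableAt
        one_ne_zero).hasFDerivAt.hasFDerivWithinAt) fun y hy => hcon y hy.1 hy.2
  have h1 := h.null _ (by rintro _ ⟨y, hy, rfl⟩; exact hy.2) hS
  have h2 := h.mapsTo
  rw [ae_restrict_iff' hΩ₂.measurableSet, ae_iff] at h2
  refine (hU.measure_pos volume hne).ne' (measure_mono_null (fun y hy => ?_)
    (measure_union_null h1 h2))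
  by_cases hy1 : ξ y ∈ Ω₁
  · exact Or.inl ⟨hUΩ hy, hg y hy, y, ⟨hy, hy1⟩, rfl⟩
  · exact Or.inr fun hc => hy1 (hc (hUΩ hy))

/-- The inverse function theorem, with an inverse that is `C¹` on its whole domain. -/
theorem ContDiffOn.exists_openPartialHomeomorph {ξ : Euc N → Euc N} (hΩ : IsOpen Ω)
    (hξ : ContDiffOn ℝ 1 ξ Ω) {y₀ : Euc N} (hy₀ : y₀ ∈ Ω) (hdet : (fderiv ℝ ξ y₀).det ≠ 0) :
    ∃ e : OpenPartialHomeomorph (Euc N) (Euc N), y₀ ∈ e.source ∧ e.source ⊆ Ω ∧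
      (∀ y, e y = ξ y) ∧ ContDiffOn ℝ 1 e.symm e.target := by
  have hder : ∀ y ∈ Ω, (fderiv ℝ ξ y).det ≠ 0 → ∃ L : Euc N ≃L[ℝ] Euc N,
      HasFDerivAt ξ (L : Euc N →L[ℝ] Euc N) y := fun y hy hd =>
    ⟨(fderiv ℝ ξ y).toContinuousLinearEquivOfDetNeZero hd, by
      simpa using ((hξ.contDiffAt (hΩ.mem_nhds hy)).differentiableAt one_ne_zero).hasFDerivAt⟩
  -- Keeping only points of nonzero Jacobian in the source makes the inverse C¹ at every point of
  -- the target.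
  have hs : IsOpen (Ω ∩ (fun y => (fderiv ℝ ξ y).det) ⁻¹' {0}ᶜ) :=
    (ContinuousLinearMap.continuous_det.comp_continuousOn
      (hξ.continuousOn_fderiv_of_isOpen hΩ le_rfl)).isOpen_inter_preimage hΩ isOpen_compl_singleton
  obtain ⟨L, hL⟩ := hder y₀ hy₀ hdet
  have hc := hξ.contDiffAt (hΩ.mem_nhds hy₀)
  refine ⟨(hc.toOpenPartialHomeomorph ξ hL one_ne_zero).restrOpen _ hs,
    ⟨hc.mem_toOpenPartialHomeomorph_source hL one_ne_zero, hy₀, hdet⟩, fun y hy => hy.2.1,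
    fun y => rfl, fun x hx => ?_⟩
  have hx' := ((hc.toOpenPartialHomeomorph ξ hL one_ne_zero).restrOpen _ hs).map_target hx
  obtain ⟨L', hL'⟩ := hder _ hx'.2.1 hx'.2.2
  exact (OpenPartialHomeomorph.contDiffAt_symm _ hx hL'
    (hξ.contDiffAt (hΩ.mem_nhds hx'.2.1))).contDiffWithinAt

/-- Extend `φ ∘ e.symm` by zero: it vanishes off the compact set `e '' tsupport φ`, which lies
inside the open target. -/
theorem OpenPartialHomeomorph.exists_contDiff_extension
    (e : OpenPartialHomeomorph (Euc N) (Euc N)) (he : ContDiffOn ℝ 1 e.symm e.target)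
    {φ : Euc N → ℝ} (hφ : ContDiff ℝ 1 φ) (hc : HasCompactSupport φ)
    (hs : tsupport φ ⊆ e.source) :
    ∃ f : Euc N → ℝ, ContDiff ℝ 1 f ∧ HasCompactSupport f ∧ (∀ y ∈ e.source, f (e y) = φ y) ∧
      ∀ x ∉ e.target, f x = 0 := by
  have hK : IsCompact (e '' tsupport φ) := hc.image_of_continuousOn (e.continuousOn.mono hs)
  have h0 : ∀ x ∉ e '' tsupport φ, e.target.indicator (φ ∘ e.symm) x = 0 := fun x hx => by
    by_cases hxt : x ∈ e.target
    · rw [Set.indicator_of_mem hxt, Function.comp_apply]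
      exact image_eq_zero_of_notMem_tsupport fun h => hx ⟨_, h, e.right_inv hxt⟩
    · exact Set.indicator_of_notMem hxt _
  refine ⟨e.target.indicator (φ ∘ e.symm), ?_, HasCompactSupport.intro hK h0, fun y hy => ?_,
    fun x hx => Set.indicator_of_notMem hx _⟩
  · rw [contDiff_iff_contDiffAt]
    intro x
    by_cases hx : x ∈ e.target
    · refine (hφ.contDiffAt.comp x (he.contDiffAt (e.open_target.mem_nhds hx))).congr_of_eventuallyEq
        ?_
      filter_upwards [e.open_target.mem_nhds hx] with z hz
      exact Set.indicator_of_mem hz _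
    · refine (contDiffAt_const (c := (0 : ℝ))).congr_of_eventuallyEq ?_
      have hxK : x ∉ e '' tsupport φ := by
        rintro ⟨y, hy, rfl⟩
        exact hx (e.map_source (hs hy))
      filter_upwards [hK.isClosed.isOpen_compl.mem_nhds hxK] with z hz
      exact h0 z hz
  · rw [Set.indicator_of_mem (e.map_source hy), Function.comp_apply, e.left_inv hy]

end LocalInverse

/-! ### The double commutator -/

section Commutator

variable {E : Type*} [NormedAddCommGroup E] [InnerProductSpace ℝ E]

/-- Bilinearity in the last two arguments cancels everything containing `X` or `Y`. It is applied
with `A = ∇g`, `G = g χ`, `X = ∇(g χ)`, `c = χ`, `Y = ∇χ`; the compound arguments are the gradients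
after multiplying by `h` once or twice. -/
theorem fluxDeriv_commutator (p : ℝ) (A X Y a : E) (G c h : ℝ) :
    fluxDeriv p A (h • (h • X + G • a) + (h * G) • a) Y -
        2 * fluxDeriv p A (h • X + G • a) (h • Y + c • a) +
        fluxDeriv p A X (h • (h • Y + c • a) + (h * c) • a) =
      -2 * (G * c * fluxDeriv p A a a) := by
  simp only [fluxDeriv, inner_add_left, inner_add_right, real_inner_smul_left,
    real_inner_smul_right]
  ring

theorem fluxDeriv_self_pos {p : ℝ} (hp : 2 < p) {A a : E} (hA : A ≠ 0) (ha : a ≠ 0) :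
    0 < fluxDeriv p A a a := by
  have h1 : 0 < ‖A‖ ^ (p - 2) := Real.rpow_pos_of_pos (norm_pos_iff.2 hA) _
  have h2 : 0 < ⟪a, a⟫ := real_inner_self_pos.2 ha
  have h3 : 0 ≤ ‖A‖ ^ (p - 4) := by positivity
  have h4 : 0 ≤ (p - 2) * ‖A‖ ^ (p - 4) := mul_nonneg (by linarith) h3
  have h5 := mul_nonneg h4 (mul_self_nonneg ⟪A, a⟫)
  rw [fluxDeriv, mul_assoc ((p - 2) * ‖A‖ ^ (p - 4))]
  linarith [mul_pos h1 h2]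

theorem integral_second_difference {α : Type*} [MeasurableSpace α] {μ : Measure α}
    {u v w : α → ℝ} (hu : Integrable u μ) (hv : Integrable v μ) (hw : Integrable w μ) :
    Integrable (fun x => u x - 2 * v x + w x) μ ∧
      ∫ x, (u x - 2 * v x + w x) ∂μ = ∫ x, u x ∂μ - 2 * ∫ x, v x ∂μ + ∫ x, w x ∂μ := by
  have h1 : Integrable (fun x => u x - 2 * v x) μ := hu.sub (hv.const_mul 2)
  refine ⟨h1.add hw, ?_⟩
  rw [integral_add h1 hw, integral_sub hu (hv.const_mul 2), integral_const_mul]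

end Commutator

/-! ### Vanishing of the gradient of the weight -/

section Main

variable {N : ℕ} {Ω₁ Ω₂ : Set (Euc N)} {p : ℝ}

theorem gradient_inner_left (a x : Euc N) : gradient (fun y => ⟪a, y⟫) x = a := by
  refine HasGradientAt.gradient (hasGradientAt_iff_hasFDerivAt.2 ?_)
  exact (innerSL ℝ a).hasFDerivAt

theorem differentiableAt_inner_left (a x : Euc N) : DifferentiableAt ℝ (fun y => ⟪a, y⟫) x :=
  (innerSL ℝ a).differentiableAt

theorem IsTestFun.inner_mul {Ω : Set (Euc N)} {φ : Euc N → ℝ} (hφ : IsTestFun Ω φ) (a : Euc N) :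
    IsTestFun Ω fun y => ⟪a, y⟫ * φ y where
  smooth := (contDiff_const.inner ℝ contDiff_id).mul hφ.smooth
  compact := hφ.compact.mul_left
  support := tsupport_mul_subset_right.trans hφ.support

theorem IsTestFun.mono {Ω Ω' : Set (Euc N)} {φ : Euc N → ℝ} (hφ : IsTestFun Ω φ) (h : Ω ⊆ Ω') :
    IsTestFun Ω' φ :=
  ⟨hφ.smooth, hφ.compact, hφ.support.trans h⟩

theorem gradient_inner_mul {φ : Euc N → ℝ} {y : Euc N} (a : Euc N)
    (hφ : DifferentiableAt ℝ φ y) :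
    gradient (fun z => ⟪a, z⟫ * φ z) y = ⟪a, y⟫ • gradient φ y + φ y • a := by
  rw [gradient_mul_apply (differentiableAt_inner_left a y) hφ, gradient_inner_left]

/-- If a weighted composition operator pulls test functions on the domain `e.source` of a `C¹`
diffeomorphism back to functions `v k`, then the latter are determined on `e.target`. -/
theorem ae_eq_zero_of_preimages {T : W1p Ω₁ p → W1pLoc Ω₂ p} {ξ : Euc N → Euc N} {g : Euc N → ℝ}
    (h1 : IsC1WeightedComposition T ξ g) (hΩ₂ : IsOpen Ω₂)
    (e : OpenPartialHomeomorph (Euc N) (Euc N)) (heξ : ∀ y, e y = ξ y) (heΩ : e.source ⊆ Ω₂)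
    (hg : ∀ y ∈ e.source, g y ≠ 0) {φ f : Fin 3 → Euc N → ℝ} {v : Fin 3 → W1p Ω₁ p}
    (hv : ∀ k, (T (v k)).1 =ᵐ[volume.restrict Ω₂] φ k)
    (hf : ∀ k, ∀ y ∈ e.source, f k (e y) = φ k y) (hf0 : ∀ k, ∀ x ∉ e.target, f k x = 0)
    (hφ : ∀ y, φ 2 y * φ 0 y = φ 1 y * φ 1 y) :
    ∀ᵐ x, f 2 x * (v 0).1 x - 2 * (f 1 x * (v 1).1 x) + f 0 x * (v 2).1 x = 0 := by
  have hall : ∀ᵐ y ∂volume.restrict Ω₂, ∀ k, g y * (v k).1 (ξ y) = φ k y := by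
    refine ae_all_iff.2 fun k => ?_
    filter_upwards [hv k, h1.eq (v k)] with y h2 h3
    rw [← h2, h3]
  rw [ae_restrict_iff' hΩ₂.measurableSet, ae_iff] at hall
  have hZ : volume {y | y ∈ e.source ∧ ¬ ∀ k, g y * (v k).1 (ξ y) = φ k y} = 0 :=
    measure_mono_null (fun y hy => by exact fun hc => hy.2 (hc (heΩ hy.1))) hall
  -- A differentiable map sends null sets to null sets, which carries the almost everywhere
  -- identities from the source to the target.
  have hξZ := addHaar_image_eq_zero_of_differentiableOn_of_addHaar_eq_zero volume
    (((h1.contDiff_ξ.differentiableOn one_ne_zero).mono heΩ).mono fun y hy => hy.1) hZ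
  refine measure_mono_null (fun x hx => ?_) hξZ
  by_contra hxZ
  refine hx ?_
  by_cases hxt : x ∈ e.target
  · obtain ⟨y, hy, rfl⟩ : ∃ y ∈ e.source, e y = x := ⟨_, e.map_target hxt, e.right_inv hxt⟩
    have hk : ∀ k, g y * (v k).1 (ξ y) = φ k y := by
      by_contra hc
      exact hxZ ⟨y, ⟨hy, hc⟩, (heξ y).symm⟩
    simp only [Set.mem_ofPred_eq, hf _ y hy]
    rw [heξ]
    refine mul_left_cancel₀ (hg y hy) ?_
    linear_combination φ 2 y * hk 0 - 2 * φ 1 y * hk 1 + φ 0 y * hk 2 + 2 * hφ y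
  · simp only [Set.mem_ofPred_eq, hf0 _ x hxt]
    ring

theorem isOpen_inter_mul_pos {U : Set (Euc N)} (hU : IsOpen U) {g : Euc N → ℝ}
    (hg : ContinuousOn g U) {y₀ : Euc N} (hy₀ : y₀ ∈ U) (h0 : g y₀ ≠ 0) :
    IsOpen (U ∩ {y | 0 < g y₀ * g y}) ∧ y₀ ∈ U ∩ {y | 0 < g y₀ * g y} :=
  ⟨(continuousOn_const.mul hg).isOpen_inter_preimage hU isOpen_Ioi, hy₀, mul_self_pos.2 h0⟩

/-- Otherwise the double commutator identity would make the integral of a function with a strict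
sign on the support of the cutoff equal to zero. -/
theorem gradient_weight_eq_zero_of_regular_point
    (hΩ₁ : IsOpen Ω₁) (hΩ₁b : Bornology.IsBounded Ω₁)
    (hΩ₂ : IsOpen Ω₂) (hΩ₂b : Bornology.IsBounded Ω₂)
    (hp : 2 < p) {T : W1p Ω₁ p → W1pLoc Ω₂ p} {ξ : Euc N → Euc N} {g : Euc N → ℝ}
    (h1 : IsC1WeightedComposition T ξ g) (h2 : IntertwinesForms T) (h3 : RangeContainsW1p0 T)
    {y₀ : Euc N} (hy₀ : y₀ ∈ Ω₂) (hg₀ : g y₀ ≠ 0) (hdet : (fderiv ℝ ξ y₀).det ≠ 0) :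
    gradient g y₀ = 0 := by
  by_contra ha
  set a := gradient g y₀
  -- a neighbourhood of `y₀` on which `ξ` is a diffeomorphism, `g` has a sign and `∇g ≠ 0`
  have hU₁ : IsOpen (Ω₂ ∩ gradient g ⁻¹' {0}ᶜ) :=
    (h1.contDiff_g.continuousOn_gradient hΩ₂).isOpen_inter_preimage hΩ₂ isOpen_compl_singleton
  obtain ⟨hU, hyU⟩ := isOpen_inter_mul_pos hU₁
    (h1.contDiff_g.continuousOn.mono Set.inter_subset_left) (y₀ := y₀) ⟨hy₀, ha⟩ hg₀
  obtain ⟨e, hye, heU, heξ, hesymm⟩ := ContDiffOn.exists_openPartialHomeomorph hU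
    (h1.contDiff_ξ.mono fun y hy => hy.1.1) hyU hdet
  have heΩ : e.source ⊆ Ω₂ := fun y hy => (heU hy).1.1
  have hge : ∀ y ∈ e.source, 0 < g y₀ * g y := fun y hy => (heU hy).2
  have hgrad : ∀ y ∈ e.source, gradient g y ≠ 0 := fun y hy => (heU hy).1.2
  -- the test functions
  obtain ⟨χ, hχs, hχc, hχ, -, hχ1⟩ := exists_contDiff_tsupport_subset (n := ⊤)
    (e.open_source.mem_nhds hye)
  let φ : Fin 3 → Euc N → ℝ :=
    ![χ, fun y => ⟪a, y⟫ * χ y, fun y => ⟪a, y⟫ * (⟪a, y⟫ * χ y)]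
  have hφ : ∀ k, IsTestFun e.source (φ k) := by
    have h0 : IsTestFun e.source χ := ⟨hχ, hχc, hχs⟩
    intro k
    fin_cases k
    · exact h0
    · exact h0.inner_mul a
    · exact (h0.inner_mul a).inner_mul a
  choose w hw0 hwc hwφ using fun k =>
    ((hφ k).mono heΩ).exists_mem_W1p0 (p := p) hΩ₂ hΩ₂b hp
  choose v hv0 hTv using fun k => h3 (w k) (hw0 k)
  choose f hf hfc hfφ hf0 using fun k => OpenPartialHomeomorph.exists_contDiff_extension e hesymm
    (hφ k).contDiff_one (hφ k).compact (hφ k).support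
  have hvφ : ∀ k, (T (v k)).1 =ᵐ[volume.restrict Ω₂] φ k := fun k => by rw [hTv k]; exact hwφ k
  have key := fun j k => intertwining_first_variation hΩ₁ hΩ₁b hΩ₂ hp h1 h2 (hf j) (hfc j)
    ((hφ k).mono heΩ) (v k) (hv0 k) (by rw [hTv k]; exact hwc k) (hvφ k)
  obtain ⟨i20, j20, k20, e20⟩ := key 2 0
  obtain ⟨i11, j11, k11, e11⟩ := key 1 1
  obtain ⟨i02, j02, k02, e02⟩ := key 0 2
  have hleft : (∫ x in Ω₁, f 2 x * (v 0).1 x) - 2 * (∫ x in Ω₁, f 1 x * (v 1).1 x) +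
      ∫ x in Ω₁, f 0 x * (v 2).1 x = 0 := by
    rw [← (integral_second_difference i20 i11 i02).2]
    refine integral_eq_zero_of_ae (ae_restrict_of_ae ?_)
    refine ae_eq_zero_of_preimages h1 hΩ₂ e heξ heΩ (fun y hy h0 => ?_) hvφ hfφ hf0 fun y => ?_
    · have := hge y hy
      rw [h0, mul_zero] at this
      exact this.false
    · simp only [φ, Matrix.cons_val]
      ring
  have hmid : (∫ y in Ω₂, fluxDeriv p (g y) (g y * f 2 (ξ y)) (φ 0 y)) -
      2 * (∫ y in Ω₂, fluxDeriv p (g y) (g y * f 1 (ξ y)) (φ 1 y)) +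
      ∫ y in Ω₂, fluxDeriv p (g y) (g y * f 0 (ξ y)) (φ 2 y) = 0 := by
    rw [← (integral_second_difference j20 j11 j02).2]
    -- The zeroth-order terms depend on `f j ∘ ξ` and `φ k` only through their product, which is `h²
    -- χ²` for all three pairs.
    refine integral_eq_zero_of_ae (Filter.Eventually.of_forall fun y => ?_)
    by_cases hy : y ∈ e.source
    · simp only [← heξ, hfφ _ y hy, fluxDeriv, RCLike.inner_apply, conj_trivial, φ,
        Matrix.cons_val, Pi.zero_apply]
      ring
    · have : ∀ k, φ k y = 0 := fun k =>
        image_eq_zero_of_notMem_tsupport fun h => hy ((hφ k).support h)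
      simp [fluxDeriv, this]
  have hpt : ∀ y,
      fluxDeriv p (gradient g y) (gradient (fun z => g z * f 2 (ξ z)) y) (gradient (φ 0) y) -
        2 * fluxDeriv p (gradient g y) (gradient (fun z => g z * f 1 (ξ z)) y)
          (gradient (φ 1) y) +
        fluxDeriv p (gradient g y) (gradient (fun z => g z * f 0 (ξ z)) y) (gradient (φ 2) y) =
      -2 * (g y * χ y * χ y * fluxDeriv p (gradient g y) a a) := fun y => by
    by_cases hy : y ∈ e.source
    · have hχd : DifferentiableAt ℝ χ y := (hφ 0).contDiff_one.differentiable one_ne_zero y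
      have hgd : DifferentiableAt ℝ (fun z => g z * χ z) y :=
        ((h1.contDiff_g.contDiffAt (hΩ₂.mem_nhds (heΩ hy))).differentiableAt one_ne_zero).mul hχd
      have hd := differentiableAt_inner_left a y
      have hloc : ∀ k, gradient (fun z => g z * f k (ξ z)) y = gradient (fun z => g z * φ k z) y :=
        fun k => by
          refine Filter.EventuallyEq.gradient_eq ?_
          filter_upwards [e.open_source.mem_nhds hy] with z hz
          rw [← heξ, hfφ k z hz]
      have hc1 : (fun z => g z * φ 1 z) = fun z => ⟪a, z⟫ * (g z * χ z) := by
        funext z; simp only [φ, Matrix.cons_val]; ring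
      have hc2 : (fun z => g z * φ 2 z) = fun z => ⟪a, z⟫ * (⟪a, z⟫ * (g z * χ z)) := by
        funext z; simp only [φ, Matrix.cons_val]; ring
      have e1 : φ 1 = fun z => ⟪a, z⟫ * χ z := rfl
      have e2 : φ 2 = fun z => ⟪a, z⟫ * (⟪a, z⟫ * χ z) := rfl
      rw [hloc, hloc, hloc, hc1, hc2, e1, e2, gradient_inner_mul a (hd.fun_mul hgd),
        gradient_inner_mul a hgd, gradient_inner_mul a (hd.fun_mul hχd), gradient_inner_mul a hχd]
      exact fluxDeriv_commutator p _ _ _ a _ _ _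
    · have hn : ∀ k, y ∉ tsupport (φ k) := fun k h => hy ((hφ k).support h)
      have hχ0 : χ y = 0 := image_eq_zero_of_notMem_tsupport (hn 0)
      have hz : ∀ A b : Euc N, fluxDeriv p A b 0 = 0 := fun A b => by simp [fluxDeriv]
      simp only [gradient_eq_zero_of_notMem_tsupport (hn _), hz, hχ0]
      ring
  have hint : IntegrableOn
      (fun y => -2 * (g y * χ y * χ y * fluxDeriv p (gradient g y) a a)) Ω₂ := by
    simp only [← hpt]
    exact (integral_second_difference k20 k11 k02).1
  have hzero : ∫ y in Ω₂, -2 * (g y * χ y * χ y * fluxDeriv p (gradient g y) a a) = 0 := by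
    simp only [← hpt]
    rw [(integral_second_difference k20 k11 k02).2]
    linear_combination (p - 1) * hleft - e20 + 2 * e11 - e02 - hmid
  -- positivity
  have hpos : ∀ y, χ y ≠ 0 → 0 < g y₀ * (g y * χ y * χ y * fluxDeriv p (gradient g y) a a) :=
    fun y hy => by
      have hye : y ∈ e.source := hχs (subset_tsupport _ hy)
      have hQ := fluxDeriv_self_pos hp (hgrad y hye) ha
      have := mul_pos (mul_pos (hge y hye) (mul_self_pos.2 hy)) hQ
      refine this.trans_eq ?_
      ring
  have hnn : ∀ y, 0 ≤ g y₀ * (g y * χ y * χ y * fluxDeriv p (gradient g y) a a) := fun y => by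
    by_cases hy : χ y = 0
    · simp [hy]
    · exact (hpos y hy).le
  have hae : (fun y => g y₀ * (g y * χ y * χ y * fluxDeriv p (gradient g y) a a))
      =ᵐ[volume.restrict Ω₂] 0 := by
    refine (integral_eq_zero_iff_of_nonneg hnn ?_).1 ?_
    -- The factor trades the `-2` of the commutator for `g y₀`, which makes the integrand
    -- nonnegative.
    · refine (hint.const_mul (-(g y₀) / 2)).congr (Filter.Eventually.of_forall fun y => ?_)
      beta_reduce
      ring
    · rw [integral_const_mul] at hzero ⊢
      rw [(mul_eq_zero.1 hzero).resolve_left (by norm_num), mul_zero]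
  rw [Filter.EventuallyEq, ae_restrict_iff' hΩ₂.measurableSet, ae_iff] at hae
  have hO : IsOpen (Function.support χ) := hχ.continuous.isOpen_support
  refine (hO.measure_pos volume ⟨y₀, by simp [hχ1]⟩).ne' (measure_mono_null (fun y hy => ?_) hae)
  exact fun hc => (hpos y hy).ne' (hc (heΩ (hχs (subset_tsupport _ hy))))

theorem proposition4p9 {N : ℕ} {Ω₁ Ω₂ : Set (Euc N)}
    (hΩ₁ : IsOpen Ω₁) (hΩ₁b : Bornology.IsBounded Ω₁)
    (hΩ₂ : IsOpen Ω₂) (hΩ₂b : Bornology.IsBounded Ω₂)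
    {p : ℝ} (hp : 2 < p) (T : W1p Ω₁ p → W1pLoc Ω₂ p)
    (ξ : Euc N → Euc N) (g : Euc N → ℝ)
    (h1 : IsC1WeightedComposition T ξ g) (h2 : IntertwinesForms T) (h3 : RangeContainsW1p0 T) :
    ∀ y ∈ Ω₂, gradient g y = 0 := by
  intro y₀ hy₀
  by_contra hne
  have hU : IsOpen (Ω₂ ∩ gradient g ⁻¹' {0}ᶜ) :=
    (h1.contDiff_g.continuousOn_gradient hΩ₂).isOpen_inter_preimage hΩ₂ isOpen_compl_singleton
  have hV := (h1.contDiff_g.continuousOn.mono Set.inter_subset_left).isOpen_inter_preimage hU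
    (isOpen_compl_singleton (x := (0 : ℝ)))
  -- If `g` vanished throughout the open set where `∇g ≠ 0`, its gradient would vanish there too.
  have hVne : ((Ω₂ ∩ gradient g ⁻¹' {0}ᶜ) ∩ g ⁻¹' {0}ᶜ).Nonempty := by
    by_contra hemp
    refine hne ?_
    have : g =ᶠ[nhds y₀] fun _ => 0 := by
      filter_upwards [hU.mem_nhds ⟨hy₀, hne⟩] with y hy
      by_contra h0
      exact hemp ⟨y, hy, h0⟩
    rw [this.gradient_eq, gradient_fun_const]
  obtain ⟨y, hy, -, hdet⟩ := h1.exists_regular_point hΩ₂ hV (fun y hy => hy.1.1) hVne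
    fun y hy => hy.2
  exact hy.1.2 (gradient_weight_eq_zero_of_regular_point hΩ₁ hΩ₁b hΩ₂ hΩ₂b hp h1 h2 h3 hy.1.1
    hy.2 hdet)

end Main
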